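/- Let $r\ge 2$ be an integer. A (weighted) $r$-partite graph is a graph $G$ whose vertex set is a disjoint union $V_1\sqcup\dots\sqcup V_r$ of finite sets such that no edge of $G$ lies inside a part $V_i$, together with a weight function $w:V(G)\to[0,1]$ satisfying $\sum_{v\in V_i}w(v)=1$ for every $i$. Its $r$-partite density is $$d_r(G)=\min_{1\le i<j\le r}\ \sum_{u\in V_i,\,v\in V_j} w(u)w(v)\mathbf 1_{uv\in E(G)}.$$ A transversal of $G$ is a subgraph of $G$ induced by a set of vertices containing exactly one vertex from each part. Given a non-empty family $\mathcal F$ of subgraphs of the complete graph $K_r$, each having at least one edge, let $\pi_{K_r}(\mathcal F)$ be the supremum of $d_r(G)$ over all weighted $r$-partite graphs $G$ such that no transversal of $G$ contains a copy of a member of $\mathcal F$. Let $\mathcal O_r$ be the family of all cycles of odd length (at least $3$) in $K_r$. Then for all $r\ge 4$, $$\pi_{K_r}(\mathcal O_r)\ \ge\ \frac12,$$ and $\pi_{K_r}(\mathcal O_r)=\frac12$ for all $r\ge 12$. -/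

import Mathlib

/-- A weighted `H`-partite graph. The vertex set is the disjoint union `Σ x, V x` of finite parts
indexed by the vertices of the host graph `H`, every edge joins two parts `V x`, `V y` with `xy` an
edge of `H`, and the weights in `[0, 1]` sum to `1` on every part (so no part is empty).
Parts are finite, so letting them range over `Type` loses no generality. -/
structure WeightedPartiteGraph {W : Type*} (H : SimpleGraph W) where
  V : W → Type
  [fintypeV : ∀ x, Fintype (V x)]
  graph : SimpleGraph (Σ x, V x)
  adj_host : ∀ u v : Σ x, V x, graph.Adj u v → H.Adj u.1 v.1
  weight : (Σ x, V x) → ℝ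
  weight_mem : ∀ v, weight v ∈ Set.Icc (0 : ℝ) 1
  sum_weight : ∀ x, ∑ v : V x, weight ⟨x, v⟩ = 1

namespace WeightedPartiteGraph

attribute [instance] WeightedPartiteGraph.fintypeV

variable {W : Type*} {H : SimpleGraph W}

open Classical in
/-- The edge density `α_{xy}` of the weighted bipartite graph between the parts `V x` and `V y`. -/
noncomputable def edgeDensity (G : WeightedPartiteGraph H) (x y : W) : ℝ :=
  ∑ u : G.V x, ∑ v : G.V y,
    G.weight ⟨x, u⟩ * G.weight ⟨y, v⟩ * (if G.graph.Adj ⟨x, u⟩ ⟨y, v⟩ then 1 else 0)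

/-- The `H`-partite density `d_H(G)`: the least of the densities `α_{xy}` over the edges `xy`
of `H`. (`H` is meant to have an edge; if `H` is finite the infimum is a minimum.) -/
noncomputable def density (G : WeightedPartiteGraph H) : ℝ :=
  sInf {a : ℝ | ∃ x y : W, H.Adj x y ∧ a = G.edgeDensity x y}

/-- The transversal of `G` given by a choice `f` of one vertex from each part: the subgraph of `G`
induced by the chosen vertices, viewed as a graph on the vertex set of `H`. -/
def transversal (G : WeightedPartiteGraph H) (f : ∀ x, G.V x) : SimpleGraph W :=
  G.graph.comap fun x => (⟨x, f x⟩ : Σ x, G.V x)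

/-- `G` has `𝓕`-free transversals: no transversal of `G` contains a copy of a member of `𝓕`. -/
def HasFreeTransversals (G : WeightedPartiteGraph H) (𝓕 : Set H.Subgraph) : Prop :=
  ∀ f : ∀ x, G.V x, ∀ F ∈ 𝓕, F.coe.Free (G.transversal f)

end WeightedPartiteGraph

/-- The threshold `π_H(𝓕)`: the supremum of the `H`-partite densities of `H`-partite graphs with
`𝓕`-free transversals. -/
noncomputable def partiteThreshold {W : Type*} (H : SimpleGraph W) (𝓕 : Set H.Subgraph) : ℝ :=
  sSup {d : ℝ | ∃ G : WeightedPartiteGraph H, G.HasFreeTransversals 𝓕 ∧ d = G.density}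

/-- The family of all odd cycles in `H`: the subgraphs of `H` isomorphic to the cycle `C_t` for some
odd `t ≥ 3`. -/
def oddCycles {W : Type*} (H : SimpleGraph W) : Set H.Subgraph :=
  {F | ∃ t : ℕ, 3 ≤ t ∧ Odd t ∧ Nonempty (F.coe ≃g SimpleGraph.cycleGraph t)}

/-! The lower bound comes from two vertices of weight 1/2 per part, joined across parts exactly when
their labels differ: this graph is bipartite.

For the upper bound, edges never lie inside a part, so a triangle meets three parts and extends to a
transversal; hence the whole graph is triangle-free. It remains to show that twelve probability
vectors on a triangle-free graph cannot all have pairwise density above 1/2.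

The main tool is `sum_pairDensity_le_of_cut`. Cut each part into an inner side of weight at most 1/2
and an outer side. Were all edges to cross, the densities would be at most 1/2. An edge inside one
side forces missing pairs to every third vertex, since no vertex sees both its ends
(`wedge_mul_le`); if these missing cross pairs pay for all non-crossing edges, the average density
is still at most 1/2.

Applied to an independent set, this shows that a neighbourhood has weight at least 1/2 on at most
two parts, which bounds the second moment of the degrees of a vertex (`sum_ndeg_sq_le`). Averaging
over edges then gives an edge `uv` whose neighbourhoods `A`, `C` cover all but 2/11 of the total
weight of the ten other parts (`exists_adj_sum_lt`). On at least six of these parts `A` and `C` both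
weigh less than 1/2. There few pairs between `A` and `C` are missing (`wmiss_le_of_triple`), so the
leftover vertices can be added to `A` or to `C` to form a cut to which the main tool applies again
(`two_div_eleven_lt_sum`), a contradiction. -/

/-! ### Weighted edge and non-edge counts in a triangle-free graph. -/

section WeightedSums

variable {V : Type*}

variable (G : SimpleGraph V)

open Classical in
/-- The indicator function of adjacency. -/
noncomputable def adjInd (u v : V) : ℝ := if G.Adj u v then 1 else 0

theorem adjInd_of_adj {u v : V} (h : G.Adj u v) : adjInd G u v = 1 := by simp [adjInd, h]

theorem adjInd_of_not_adj {u v : V} (h : ¬ G.Adj u v) : adjInd G u v = 0 := by simp [adjInd, h]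

theorem adjInd_comm (u v : V) : adjInd G u v = adjInd G v u := by
  by_cases h : G.Adj u v
  · rw [adjInd_of_adj G h, adjInd_of_adj G h.symm]
  · rw [adjInd_of_not_adj G h, adjInd_of_not_adj G fun h' => h h'.symm]

theorem adjInd_nonneg (u v : V) : 0 ≤ adjInd G u v := by
  unfold adjInd; split_ifs <;> norm_num

theorem adjInd_le_one (u v : V) : adjInd G u v ≤ 1 := by
  unfold adjInd; split_ifs <;> norm_num

/-- No three vertices are pairwise adjacent. -/
def TriangleFree : Prop := ∀ u v t, G.Adj u v → G.Adj v t → ¬ G.Adj u t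

variable [Fintype V]

/-- The sum of `f` weighted by `p`. -/
def avg (p f : V → ℝ) : ℝ := ∑ v, p v * f v

/-- `p` is a probability vector. -/
def IsProb (p : V → ℝ) : Prop := (∀ v, 0 ≤ p v) ∧ ∑ v, p v = 1

theorem avg_mono {p f h : V → ℝ} (hp : IsProb p) (H : ∀ v, f v ≤ h v) : avg p f ≤ avg p h :=
  Finset.sum_le_sum fun v _ => mul_le_mul_of_nonneg_left (H v) (hp.1 v)

theorem avg_nonneg {p f : V → ℝ} (hp : IsProb p) (H : ∀ v, 0 ≤ f v) : 0 ≤ avg p f :=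
  Finset.sum_nonneg fun v _ => mul_nonneg (hp.1 v) (H v)

theorem avg_add (p f h : V → ℝ) : avg p (fun v => f v + h v) = avg p f + avg p h := by
  simp [avg, mul_add, Finset.sum_add_distrib]

theorem avg_sub (p f h : V → ℝ) : avg p (fun v => f v - h v) = avg p f - avg p h := by
  simp [avg, mul_sub, Finset.sum_sub_distrib]

theorem avg_const_mul (p f : V → ℝ) (c : ℝ) : avg p (fun v => c * f v) = c * avg p f := by
  simp only [avg, Finset.mul_sum]
  exact Finset.sum_congr rfl fun v _ => by ring

theorem avg_mul_const (p f : V → ℝ) (c : ℝ) : avg p (fun v => f v * c) = avg p f * c := by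
  simp only [avg, Finset.sum_mul]
  exact Finset.sum_congr rfl fun v _ => by ring

theorem avg_const {p : V → ℝ} (hp : IsProb p) (c : ℝ) : avg p (fun _ => c) = c := by
  simp only [avg, ← Finset.sum_mul, hp.2, one_mul]

theorem avg_sum {ι : Type*} (s : Finset ι) (p : V → ℝ) (f : ι → V → ℝ) :
    avg p (fun v => ∑ i ∈ s, f i v) = ∑ i ∈ s, avg p (f i) := by
  simp only [avg, Finset.mul_sum]
  exact Finset.sum_comm

theorem avg_comm (p q : V → ℝ) (f : V → V → ℝ) :
    avg p (fun u => avg q (fun v => f u v)) = avg q (fun v => avg p (fun u => f u v)) := by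
  simp only [avg, Finset.mul_sum]
  rw [Finset.sum_comm]
  exact Finset.sum_congr rfl fun v _ => Finset.sum_congr rfl fun u _ => by ring

theorem avg_one_sub {p : V → ℝ} (hp : IsProb p) (f : V → ℝ) :
    avg p (fun v => 1 - f v) = 1 - avg p f := by
  rw [avg_sub, avg_const hp]

theorem avg_le_one {p f : V → ℝ} (hp : IsProb p) (H : ∀ v, f v ≤ 1) : avg p f ≤ 1 :=
  (avg_mono hp H).trans_eq (avg_const hp 1)

/-- The weighted degree of `u` into the weight function `f`. -/
noncomputable def wdeg (q f : V → ℝ) (u : V) : ℝ := avg q (fun v => f v * adjInd G u v)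

/-- The weighted number of non-neighbours of `u` in the weight function `f`. -/
noncomputable def wcodeg (q f : V → ℝ) (u : V) : ℝ := avg q (fun v => f v * (1 - adjInd G u v))

/-- The weighted number of edges between `f` and `h`. -/
noncomputable def wedge (p q f h : V → ℝ) : ℝ := avg p (fun u => f u * wdeg G q h u)

/-- The weighted number of missing edges between `f` and `h`. -/
noncomputable def wmiss (p q f h : V → ℝ) : ℝ := avg p (fun u => f u * wcodeg G q h u)

/-- The edge density between two probability vectors. -/
noncomputable def pairDensity (p q : V → ℝ) : ℝ := wedge G p q (fun _ => 1) (fun _ => 1)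

variable {G} {p q s : V → ℝ}

theorem wdeg_nonneg (hq : IsProb q) {f : V → ℝ} (hf : ∀ v, 0 ≤ f v) (u : V) :
    0 ≤ wdeg G q f u :=
  avg_nonneg hq fun v => mul_nonneg (hf v) (adjInd_nonneg G u v)

theorem wdeg_le (hq : IsProb q) {f : V → ℝ} (hf : ∀ v, 0 ≤ f v) (u : V) :
    wdeg G q f u ≤ avg q f :=
  avg_mono hq fun v => mul_le_of_le_one_right (hf v) (adjInd_le_one G u v)

theorem wdeg_add (f h : V → ℝ) (u : V) :
    wdeg G q (fun v => f v + h v) u = wdeg G q f u + wdeg G q h u := by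
  simp only [wdeg, add_mul, avg_add]

theorem wcodeg_nonneg (hq : IsProb q) {f : V → ℝ} (hf : ∀ v, 0 ≤ f v) (u : V) :
    0 ≤ wcodeg G q f u :=
  avg_nonneg hq fun v => mul_nonneg (hf v) (sub_nonneg.2 (adjInd_le_one G u v))

theorem wcodeg_eq (f : V → ℝ) (u : V) : wcodeg G q f u = avg q f - wdeg G q f u := by
  simp only [wcodeg, wdeg, ← avg_sub]
  congr 1; ext v; ring

theorem wmiss_eq (f h : V → ℝ) : wmiss G p q f h = avg p f * avg q h - wedge G p q f h := by
  simp only [wmiss, wedge, wcodeg_eq, mul_sub, avg_sub, avg_mul_const]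

theorem wedge_comm (f h : V → ℝ) : wedge G p q f h = wedge G q p h f := by
  simp only [wedge, wdeg, ← avg_const_mul]
  rw [avg_comm]
  congr 1; ext v; congr 1; ext u; rw [adjInd_comm]; ring

theorem wmiss_comm (f h : V → ℝ) : wmiss G p q f h = wmiss G q p h f := by
  rw [wmiss_eq, wmiss_eq, wedge_comm, mul_comm]

theorem wedge_add_left (f f' h : V → ℝ) :
    wedge G p q (fun v => f v + f' v) h = wedge G p q f h + wedge G p q f' h := by
  simp only [wedge, add_mul, avg_add]

theorem wedge_add_right (f h h' : V → ℝ) :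
    wedge G p q f (fun v => h v + h' v) = wedge G p q f h + wedge G p q f h' := by
  simp only [wedge, wdeg_add, mul_add, avg_add]

theorem wedge_nonneg (hp : IsProb p) (hq : IsProb q) {f h : V → ℝ} (hf : ∀ v, 0 ≤ f v)
    (hh : ∀ v, 0 ≤ h v) : 0 ≤ wedge G p q f h :=
  avg_nonneg hp fun u => mul_nonneg (hf u) (wdeg_nonneg hq hh u)

theorem wmiss_nonneg (hp : IsProb p) (hq : IsProb q) {f h : V → ℝ} (hf : ∀ v, 0 ≤ f v)
    (hh : ∀ v, 0 ≤ h v) : 0 ≤ wmiss G p q f h :=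
  avg_nonneg hp fun u => mul_nonneg (hf u) (wcodeg_nonneg hq hh u)

theorem wedge_le (hp : IsProb p) (hq : IsProb q) {f h : V → ℝ} (hf : ∀ v, 0 ≤ f v)
    (hh : ∀ v, 0 ≤ h v) : wedge G p q f h ≤ avg p f * avg q h := by
  have := wmiss_nonneg (G := G) hp hq hf hh
  rw [wmiss_eq] at this; linarith

/-- The edge density, split along cuts of the two sides. -/
theorem pairDensity_eq_cut (hp : IsProb p) (hq : IsProb q) (f h : V → ℝ) :
    pairDensity G p q = avg p f * (1 - avg q h) + (1 - avg p f) * avg q h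
      - wmiss G p q f (fun v => 1 - h v) - wmiss G p q (fun v => 1 - f v) h
      + wedge G p q f h + wedge G p q (fun v => 1 - f v) (fun v => 1 - h v) := by
  have h1 : pairDensity G p q
      = wedge G p q (fun v => f v + (1 - f v)) (fun v => h v + (1 - h v)) := by
    simp [pairDensity]
  rw [h1, wedge_add_left, wedge_add_right, wedge_add_right, wmiss_eq, wmiss_eq,
    avg_one_sub hp, avg_one_sub hq]
  ring

/-- In a triangle-free graph the two ends of an edge have no common neighbour, so every edge
between `f` and `f'` comes with missing edges to `h`. -/
theorem wedge_mul_le (hG : TriangleFree G) (hp : IsProb p) (hq : IsProb q) (hs : IsProb s)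
    {f f' h : V → ℝ} (hf : ∀ v, 0 ≤ f v) (hf' : ∀ v, 0 ≤ f' v) (hh : ∀ v, 0 ≤ h v) :
    wedge G p q f f' * avg s h ≤ avg p (fun u => f u * (wdeg G q f' u * wcodeg G s h u))
      + avg q (fun v => f' v * (wdeg G p f v * wcodeg G s h v)) := by
  have h1 : avg q (fun v => f' v * (wdeg G p f v * wcodeg G s h v))
      = avg p (fun u => avg q fun v => f u * f' v * adjInd G u v * wcodeg G s h v) := by
    rw [avg_comm]
    congr 1; ext v
    rw [mul_comm (wdeg G p f v), ← mul_assoc, wdeg, ← avg_const_mul]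
    congr 1; ext u; rw [adjInd_comm]; ring
  have h2 : avg p (fun u => f u * (wdeg G q f' u * wcodeg G s h u))
      = avg p (fun u => avg q fun v => f u * f' v * adjInd G u v * wcodeg G s h u) := by
    congr 1; ext u
    rw [mul_comm (wdeg G q f' u), ← mul_assoc, wdeg, ← avg_const_mul]
    congr 1; ext v; ring
  have h3 : wedge G p q f f' * avg s h
      = avg p (fun u => avg q fun v => f u * f' v * adjInd G u v * avg s h) := by
    rw [wedge, ← avg_mul_const]
    congr 1; ext u
    rw [wdeg, mul_assoc, ← avg_mul_const, ← avg_const_mul]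
    congr 1; ext v; ring
  rw [h1, h2, h3, ← avg_add]
  refine avg_mono hp fun u => ?_
  rw [← avg_add]
  refine avg_mono hq fun v => ?_
  rw [← mul_add]
  by_cases huv : G.Adj u v
  · refine mul_le_mul_of_nonneg_left ?_
      (mul_nonneg (mul_nonneg (hf u) (hf' v)) (adjInd_nonneg G u v))
    rw [wcodeg, wcodeg, ← avg_add]
    refine avg_mono hs fun t => ?_
    rw [← mul_add]
    refine le_mul_of_one_le_right (hh t) ?_
    by_cases hvt : G.Adj v t
    · rw [adjInd_of_not_adj G (hG u v t huv hvt)]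
      linarith [adjInd_le_one G v t]
    · rw [adjInd_of_not_adj G hvt]
      linarith [adjInd_le_one G u t]
  · simp [adjInd_of_not_adj G huv]

end WeightedSums

/-! ### Symmetry of sums over ordered pairs and triples of distinct indices. -/

section DistinctSums

variable {ι : Type*} [DecidableEq ι]

theorem sum_erase_eq_ite (K : Finset ι) (k : ι) (f : ι → ℝ) :
    ∑ l ∈ K.erase k, f l = ∑ l ∈ K, if l ≠ k then f l else 0 := by
  rw [← Finset.sum_filter, Finset.filter_ne']

theorem sum_pairs_swap (K : Finset ι) (f : ι → ι → ℝ) :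
    ∑ k ∈ K, ∑ l ∈ K.erase k, f k l = ∑ k ∈ K, ∑ l ∈ K.erase k, f l k := by
  simp only [sum_erase_eq_ite]
  rw [Finset.sum_comm]
  refine Finset.sum_congr rfl fun k _ => Finset.sum_congr rfl fun l _ => ?_
  simp only [ne_comm]

/-- With independent ranges and an indicator, `Finset.sum_comm` can permute the indices. -/
theorem sum_triples_eq_ite (K : Finset ι) (f : ι → ι → ι → ℝ) :
    ∑ k ∈ K, ∑ l ∈ K.erase k, ∑ m ∈ (K.erase k).erase l, f k l m
      = ∑ k ∈ K, ∑ l ∈ K, ∑ m ∈ K, if k ≠ l ∧ k ≠ m ∧ l ≠ m then f k l m else 0 := by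
  refine Finset.sum_congr rfl fun k _ => ?_
  rw [sum_erase_eq_ite]
  refine Finset.sum_congr rfl fun l _ => ?_
  rw [sum_erase_eq_ite, sum_erase_eq_ite]
  split_ifs with h
  · refine Finset.sum_congr rfl fun m _ => ?_
    by_cases h1 : m = k <;> by_cases h2 : m = l <;> simp_all [eq_comm]
  · symm; apply Finset.sum_eq_zero; intro m _
    simp_all

theorem sum_triples_swap₁₂ (K : Finset ι) (f : ι → ι → ι → ℝ) :
    ∑ k ∈ K, ∑ l ∈ K.erase k, ∑ m ∈ (K.erase k).erase l, f k l m
      = ∑ k ∈ K, ∑ l ∈ K.erase k, ∑ m ∈ (K.erase k).erase l, f l k m := by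
  simp only [sum_triples_eq_ite]
  rw [Finset.sum_comm]
  refine Finset.sum_congr rfl fun k _ => Finset.sum_congr rfl fun l _ =>
    Finset.sum_congr rfl fun m _ => if_congr ?_ rfl rfl
  tauto

theorem sum_triples_swap₂₃ (K : Finset ι) (f : ι → ι → ι → ℝ) :
    ∑ k ∈ K, ∑ l ∈ K.erase k, ∑ m ∈ (K.erase k).erase l, f k l m
      = ∑ k ∈ K, ∑ l ∈ K.erase k, ∑ m ∈ (K.erase k).erase l, f k m l := by
  simp only [sum_triples_eq_ite]
  refine Finset.sum_congr rfl fun k _ => ?_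
  rw [Finset.sum_comm]
  refine Finset.sum_congr rfl fun l _ => Finset.sum_congr rfl fun m _ => if_congr ?_ rfl rfl
  tauto

end DistinctSums

/-! ### Charging non-crossing edges to missing cross edges. -/

section CutLemma

variable {V : Type*} [Fintype V] {G : SimpleGraph V} {ι : Type*} [DecidableEq ι]

/-- A cut `x k, 1 - x k` of each part with `x k` of weight at most `1 / 2` whose inner edges are
paid for by missing cross edges bounds the densities. Edges inside `x` are charged to all missing
cross edges at rate `c`, edges inside `1 - x` between the parts `m` and `l` only to those at
`a ≤ x`, at rate `b m l`. -/
theorem sum_pairDensity_le_of_cut (hG : TriangleFree G) (K : Finset ι) (μ : ι → V → ℝ)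
    (hμ : ∀ k, IsProb (μ k)) (x a : ι → V → ℝ) (hx0 : ∀ k v, 0 ≤ x k v)
    (hx1 : ∀ k v, x k v ≤ 1) (ha0 : ∀ k v, 0 ≤ a k v)
    (hhalf : ∀ k ∈ K, avg (μ k) (x k) ≤ 1 / 2) (c : ℝ)
    (hc0 : 0 ≤ c) (b : ι → ι → ℝ) (hb0 : ∀ k l, 0 ≤ b k l) (hbs : ∀ k l, b k l = b l k)
    (hc : ∀ k ∈ K, ∀ l ∈ K, k ≠ l →
      1 ≤ c * ∑ m ∈ (K.erase k).erase l, avg (μ m) (fun v => 1 - x m v))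
    (hb : ∀ k ∈ K, ∀ l ∈ K, k ≠ l →
      wedge G (μ k) (μ l) (fun v => 1 - x k v) (fun v => 1 - x l v) = 0 ∨
        1 ≤ b k l * ∑ m ∈ (K.erase k).erase l, avg (μ m) (a m))
    (hcharge : ∀ k ∈ K, ∀ m ∈ K, k ≠ m → ∀ u t, x m t ≠ 1 →
      x k u * ∑ l ∈ (K.erase k).erase m, c * wdeg G (μ l) (x l) u
        + a k u * ∑ l ∈ (K.erase k).erase m, b m l * wdeg G (μ l) (fun v => 1 - x l v) t
        ≤ x k u) :
    ∑ k ∈ K, ∑ l ∈ K.erase k, pairDensity G (μ k) (μ l)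
      ≤ ∑ k ∈ K, ∑ l ∈ K.erase k, (1 / 2 : ℝ) := by
  set y : ι → V → ℝ := fun k v => 1 - x k v with hy
  have hy0 : ∀ k v, 0 ≤ y k v := fun k v => sub_nonneg.2 (hx1 k v)
  set FX : ι → ι → ι → ℝ := fun k l m =>
    avg (μ k) (fun u => x k u * (wdeg G (μ l) (x l) u * wcodeg G (μ m) (y m) u)) with hFX
  set FY : ι → ι → ι → ℝ := fun k l m =>
    avg (μ k) (fun u => y k u * (wdeg G (μ l) (y l) u * wcodeg G (μ m) (a m) u)) with hFY
  have hX : ∀ k ∈ K, ∀ l ∈ K.erase k, wedge G (μ k) (μ l) (x k) (x l)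
      ≤ ∑ m ∈ (K.erase k).erase l, c * (FX k l m + FX l k m) := by
    intro k hk l hl
    have h0 := wedge_nonneg (G := G) (hμ k) (hμ l) (hx0 k) (hx0 l)
    have h1 := hc k hk l (Finset.mem_of_mem_erase hl) (Finset.ne_of_mem_erase hl).symm
    calc wedge G (μ k) (μ l) (x k) (x l)
        ≤ wedge G (μ k) (μ l) (x k) (x l)
          * (c * ∑ m ∈ (K.erase k).erase l, avg (μ m) (y m)) := le_mul_of_one_le_right h0 h1
      _ = ∑ m ∈ (K.erase k).erase l,
          c * (wedge G (μ k) (μ l) (x k) (x l) * avg (μ m) (y m)) := by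
        simp only [Finset.mul_sum]
        exact Finset.sum_congr rfl fun m _ => by ring
      _ ≤ _ := Finset.sum_le_sum fun m _ => mul_le_mul_of_nonneg_left
        (wedge_mul_le hG (hμ k) (hμ l) (hμ m) (hx0 k) (hx0 l) (hy0 m)) hc0
  have hY : ∀ k ∈ K, ∀ l ∈ K.erase k, wedge G (μ k) (μ l) (y k) (y l)
      ≤ ∑ m ∈ (K.erase k).erase l, b k l * (FY k l m + FY l k m) := by
    intro k hk l hl
    have h0 := wedge_nonneg (G := G) (hμ k) (hμ l) (hy0 k) (hy0 l)
    have h1 : wedge G (μ k) (μ l) (y k) (y l) ≤ wedge G (μ k) (μ l) (y k) (y l)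
          * (b k l * ∑ m ∈ (K.erase k).erase l, avg (μ m) (a m)) := by
      rcases hb k hk l (Finset.mem_of_mem_erase hl) (Finset.ne_of_mem_erase hl).symm with h | h
      · rw [show wedge G (μ k) (μ l) (y k) (y l) = 0 from h, zero_mul]
      · exact le_mul_of_one_le_right h0 h
    refine h1.trans ?_
    simp only [Finset.mul_sum]
    refine Finset.sum_le_sum fun m _ => ?_
    rw [mul_left_comm]
    exact mul_le_mul_of_nonneg_left
      (wedge_mul_le hG (hμ k) (hμ l) (hμ m) (hy0 k) (hy0 l) (ha0 m)) (hb0 k l)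
  -- All charges to missing pairs `(u, t)` between `x k` and `y m` are collected here; `hcharge`
  -- says that no pair is overcharged. When `x m t = 1` the pair carries no weight.
  have hM : ∀ k ∈ K, ∀ m ∈ K.erase k,
      ∑ l ∈ (K.erase k).erase m, (c * FX k l m + b m l * FY m l k)
        ≤ wmiss G (μ k) (μ m) (x k) (y m) := by
    intro k hk m hm
    have e1 : ∀ l, FX k l m = avg (μ k) fun u => avg (μ m) fun t =>
        y m t * (1 - adjInd G u t) * (x k u * wdeg G (μ l) (x l) u) := by
      intro l
      simp only [hFX]; congr 1; ext u
      rw [avg_mul_const, ← wcodeg]; ring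
    have e2 : ∀ l, FY m l k = avg (μ k) fun u => avg (μ m) fun t =>
        y m t * (1 - adjInd G u t) * (a k u * wdeg G (μ l) (y l) t) := by
      intro l
      rw [avg_comm]
      simp only [hFY]; congr 1; ext t
      rw [mul_comm (wdeg G (μ l) (y l) t), ← mul_assoc, wcodeg, ← avg_const_mul, ← avg_mul_const]
      congr 1; ext u; rw [adjInd_comm]; ring
    have e3 : ∑ l ∈ (K.erase k).erase m, (c * FX k l m + b m l * FY m l k)
        = avg (μ k) fun u => avg (μ m) fun t => y m t * (1 - adjInd G u t) *
          (x k u * ∑ l ∈ (K.erase k).erase m, c * wdeg G (μ l) (x l) u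
            + a k u * ∑ l ∈ (K.erase k).erase m, b m l * wdeg G (μ l) (y l) t) := by
      simp only [e1, e2, ← avg_const_mul, ← avg_add, ← avg_sum]
      congr 1; ext u; congr 1; ext t
      simp only [Finset.mul_sum, ← Finset.sum_add_distrib]
      exact Finset.sum_congr rfl fun l _ => by ring
    rw [e3, wmiss]
    refine avg_mono (hμ k) fun u => ?_
    rw [wcodeg, ← avg_const_mul]
    refine avg_mono (hμ m) fun t => ?_
    rw [mul_comm (x k u) (y m t * _)]
    by_cases ht : x m t = 1
    · simp [hy, ht]
    · exact mul_le_mul_of_nonneg_left (hcharge k hk m (Finset.mem_of_mem_erase hm)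
        (Finset.ne_of_mem_erase hm).symm u t ht)
        (mul_nonneg (hy0 m t) (sub_nonneg.2 (adjInd_le_one G u t)))
  -- Both ends of an edge contribute the same total over ordered triples, whence the factor 2. It is
  -- matched by the two missing-edge terms in each density.
  have sX : ∑ k ∈ K, ∑ l ∈ K.erase k, wedge G (μ k) (μ l) (x k) (x l)
      ≤ 2 * ∑ k ∈ K, ∑ m ∈ K.erase k, ∑ l ∈ (K.erase k).erase m, c * FX k l m := by
    refine (Finset.sum_le_sum fun k hk => Finset.sum_le_sum fun l hl => hX k hk l hl).trans ?_
    simp only [mul_add, Finset.sum_add_distrib]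
    rw [sum_triples_swap₁₂ K (fun k l m => c * FX l k m),
      sum_triples_swap₂₃ K (fun k l m => c * FX k l m), two_mul]
  have sY : ∑ k ∈ K, ∑ l ∈ K.erase k, wedge G (μ k) (μ l) (y k) (y l)
      ≤ 2 * ∑ k ∈ K, ∑ m ∈ K.erase k, ∑ l ∈ (K.erase k).erase m, b m l * FY m l k := by
    refine (Finset.sum_le_sum fun k hk => Finset.sum_le_sum fun l hl => hY k hk l hl).trans ?_
    simp only [mul_add, Finset.sum_add_distrib]
    rw [sum_triples_swap₁₂ K (fun k m l => b m l * FY m l k),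
      sum_triples_swap₂₃ K (fun k m l => b k l * FY k l m),
      sum_triples_swap₁₂ K (fun k l m => b k l * FY l k m), two_mul]
    simp only [hbs, le_refl]
  have sM : ∑ k ∈ K, ∑ m ∈ K.erase k, ∑ l ∈ (K.erase k).erase m, c * FX k l m
      + ∑ k ∈ K, ∑ m ∈ K.erase k, ∑ l ∈ (K.erase k).erase m, b m l * FY m l k
      ≤ ∑ k ∈ K, ∑ m ∈ K.erase k, wmiss G (μ k) (μ m) (x k) (y m) := by
    simp only [← Finset.sum_add_distrib]
    exact Finset.sum_le_sum fun k hk => Finset.sum_le_sum fun m hm => hM k hk m hm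
  have hpair : ∀ k ∈ K, ∀ l ∈ K.erase k, pairDensity G (μ k) (μ l)
      ≤ 1 / 2 - wmiss G (μ k) (μ l) (x k) (y l) - wmiss G (μ l) (μ k) (x l) (y k)
        + wedge G (μ k) (μ l) (x k) (x l) + wedge G (μ k) (μ l) (y k) (y l) := by
    intro k hk l hl
    rw [pairDensity_eq_cut (hμ k) (hμ l) (x k) (x l), wmiss_comm (p := μ l)]
    -- For cut weights `a`, `b`: `a(1-b) + (1-a)b = 1/2 - 2(1/2-a)(1/2-b)`.
    nlinarith [mul_nonneg (sub_nonneg.2 (hhalf k hk))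
      (sub_nonneg.2 (hhalf l (Finset.mem_of_mem_erase hl)))]
  refine (Finset.sum_le_sum fun k hk => Finset.sum_le_sum fun l hl => hpair k hk l hl).trans ?_
  simp only [Finset.sum_add_distrib, Finset.sum_sub_distrib]
  rw [← sum_pairs_swap K (fun k l => wmiss G (μ k) (μ l) (x k) (y l))]
  linarith

end CutLemma

/-! ### Independent sets and the degrees of one vertex into the parts. -/

section Neighbourhoods

variable {V : Type*} [Fintype V] {G : SimpleGraph V} {ι : Type*} [DecidableEq ι]

theorem not_sum_pairs_le_half (K : Finset ι) (hK : 1 < K.card) (f : ι → ι → ℝ)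
    (hf : ∀ k ∈ K, ∀ l ∈ K, k ≠ l → 1 / 2 < f k l) :
    ¬ ∑ k ∈ K, ∑ l ∈ K.erase k, f k l ≤ ∑ k ∈ K, ∑ l ∈ K.erase k, (1 / 2 : ℝ) := by
  rw [not_le]
  refine Finset.sum_lt_sum_of_nonempty (Finset.card_pos.1 (by omega)) fun k hk => ?_
  refine Finset.sum_lt_sum_of_nonempty (Finset.card_pos.1 ?_) fun l hl =>
    hf k hk l (Finset.mem_of_mem_erase hl) (Finset.ne_of_mem_erase hl).symm
  rw [Finset.card_erase_of_mem hk]; omega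

theorem sum_erase_erase_of_card_three {K : Finset ι} (hK : K.card = 3) {k l m : ι} (hk : k ∈ K)
    (hl : l ∈ K) (hm : m ∈ K) (hkl : k ≠ l) (hkm : k ≠ m) (hlm : l ≠ m) (f : ι → ℝ) :
    ∑ i ∈ (K.erase k).erase l, f i = f m := by
  have h : m ∈ (K.erase k).erase l := by simp [*, hkm.symm, hlm.symm]
  have h1 : ((K.erase k).erase l).card = 1 := by
    rw [Finset.card_erase_of_mem (by simp [*, hkl.symm]), Finset.card_erase_of_mem hk, hK]
  obtain ⟨m', hm'⟩ := Finset.card_eq_one.1 h1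
  rw [hm', Finset.mem_singleton] at h
  rw [hm', Finset.sum_singleton, h]

theorem exists_third {K : Finset ι} (hK : K.card = 3) {k l : ι} (hk : k ∈ K)
    (hl : l ∈ K) (hkl : k ≠ l) : ∃ m ∈ K, k ≠ m ∧ l ≠ m := by
  have h1 : 0 < ((K.erase k).erase l).card := by
    rw [Finset.card_erase_of_mem (by simp [*, hkl.symm]), Finset.card_erase_of_mem hk, hK]
    norm_num
  obtain ⟨m, hm⟩ := Finset.card_pos.1 h1
  simp only [Finset.mem_erase] at hm
  exact ⟨m, hm.2.2, hm.2.1.symm, hm.1.symm⟩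

/-- An independent weight function has weight less than `1 / 2` on one of any three parts with
pairwise densities above `1 / 2`. -/
theorem exists_avg_lt_half (hG : TriangleFree G) (K : Finset ι) (hK : K.card = 3) (μ : ι → V → ℝ)
    (hμ : ∀ k, IsProb (μ k)) (hα : ∀ k ∈ K, ∀ l ∈ K, k ≠ l → 1 / 2 < pairDensity G (μ k) (μ l))
    (f : V → ℝ) (hf0 : ∀ v, 0 ≤ f v) (hf1 : ∀ v, f v ≤ 1)
    (hf : ∀ u v, G.Adj u v → f u * f v = 0) :
    ∃ k ∈ K, avg (μ k) f < 1 / 2 := by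
  by_contra! hcon
  refine not_sum_pairs_le_half K (by omega) _ hα ?_
  have h1 : ∀ k, avg (μ k) (fun v => 1 - f v) = 1 - avg (μ k) f := fun k => avg_one_sub (hμ k) f
  -- The outer side is `f`, which spans no edges, so nothing is charged there and `a = b = 0`. The
  -- rate 2 is forced by the single third part, of outer weight at least 1/2.
  refine sum_pairDensity_le_of_cut hG K μ hμ (fun _ v => 1 - f v) (fun _ _ => 0)
    (fun _ v => sub_nonneg.2 (hf1 v)) (fun _ v => by linarith [hf0 v]) (fun _ _ => le_rfl)
    (fun k hk => by rw [h1]; linarith [hcon k hk]) 2 (by norm_num) (fun _ _ => 0)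
    (fun _ _ => le_rfl) (fun _ _ => rfl) ?_ ?_ ?_
  · intro k hk l hl hkl
    obtain ⟨m, hm, hkm, hlm⟩ := exists_third hK hk hl hkl
    rw [sum_erase_erase_of_card_three hK hk hl hm hkl hkm hlm]
    simp only [sub_sub_cancel]
    linarith [hcon m hm]
  · intro k hk l hl hkl
    left
    simp only [sub_sub_cancel, wedge, wdeg, ← avg_const_mul]
    rw [← avg_const (hμ k) 0]
    congr 1; ext u
    rw [← avg_const (hμ l) 0]
    congr 1; ext v
    by_cases huv : G.Adj u v
    · rw [← mul_assoc, hf u v huv, zero_mul]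
    · rw [adjInd_of_not_adj G huv, mul_zero, mul_zero]
  · intro k hk m hm hkm u t _
    obtain ⟨l, hl, hkl, hml⟩ := exists_third hK hk hm hkm
    rw [sum_erase_erase_of_card_three hK hk hm hl hkm hkl hml, zero_mul, add_zero]
    refine mul_le_of_le_one_right (sub_nonneg.2 (hf1 u)) ?_
    have := wdeg_le (G := G) (hμ l) (f := fun v => 1 - f v) (fun v => sub_nonneg.2 (hf1 v)) u
    rw [h1] at this
    linarith [hcon l hl]

/-- The weight of the neighbourhood of `u`. -/
noncomputable def ndeg (G : SimpleGraph V) (p : V → ℝ) (u : V) : ℝ := avg p (adjInd G u)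

theorem ndeg_nonneg {p : V → ℝ} (hp : IsProb p) (u : V) : 0 ≤ ndeg G p u :=
  avg_nonneg hp fun v => adjInd_nonneg G u v

theorem ndeg_le_one {p : V → ℝ} (hp : IsProb p) (u : V) : ndeg G p u ≤ 1 :=
  avg_le_one hp fun v => adjInd_le_one G u v

theorem pairDensity_eq_avg_ndeg (p q : V → ℝ) : pairDensity G p q = avg p (ndeg G q) := by
  simp only [pairDensity, wedge, wdeg, one_mul]
  rfl

theorem TriangleFree.adjInd_mul_eq_zero (hG : TriangleFree G) (w : V) {u v : V}
    (h : G.Adj u v) : adjInd G w u * adjInd G w v = 0 := by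
  by_cases hu : G.Adj w u
  · rw [adjInd_of_not_adj G (hG w u v hu h), mul_zero]
  · rw [adjInd_of_not_adj G hu, zero_mul]

theorem card_half_le_ndeg (hG : TriangleFree G) (J : Finset ι) (μ : ι → V → ℝ)
    (hμ : ∀ k, IsProb (μ k)) (hα : ∀ k l, k ≠ l → 1 / 2 < pairDensity G (μ k) (μ l)) (u : V) :
    (J.filter fun k => 1 / 2 ≤ ndeg G (μ k) u).card ≤ 2 := by
  by_contra! h
  obtain ⟨K, hKJ, hK⟩ := Finset.exists_subset_card_eq (n := 3) h
  obtain ⟨k, hk, hlt⟩ := exists_avg_lt_half hG K hK μ hμ (fun k _ l _ => hα k l) (adjInd G u)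
    (adjInd_nonneg G u) (adjInd_le_one G u) fun v w h => hG.adjInd_mul_eq_zero u h
  exact absurd (Finset.mem_filter.1 (hKJ hk)).2 (not_le.2 hlt)

theorem wedge_eq_zero {p q f h : V → ℝ} (H : ∀ u v, G.Adj u v → f u * h v = 0) :
    wedge G p q f h = 0 := by
  simp only [wedge, wdeg, avg, Finset.mul_sum]
  refine Finset.sum_eq_zero fun u _ => Finset.sum_eq_zero fun v _ => ?_
  by_cases huv : G.Adj u v
  · linear_combination (p u * q v * adjInd G u v) * H u v huv
  · rw [adjInd_of_not_adj G huv]; ring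

/-- The neighbours of `u` under `p` and those under `q` span no edge. -/
theorem pairDensity_le_one_sub {p q : V → ℝ} (hG : TriangleFree G) (hp : IsProb p)
    (hq : IsProb q) (u : V) : pairDensity G p q ≤ 1 - ndeg G p u * ndeg G q u := by
  have hf0 := adjInd_nonneg G u
  have hf1 : ∀ v, 0 ≤ 1 - adjInd G u v := fun v => sub_nonneg.2 (adjInd_le_one G u v)
  have h1 := wedge_le (G := G) hp hq hf1 hf1
  have h2 := wmiss_nonneg (G := G) hp hq hf0 hf1
  have h3 := wmiss_nonneg (G := G) hp hq hf1 hf0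
  rw [pairDensity_eq_cut hp hq (adjInd G u) (adjInd G u),
    wedge_eq_zero (f := adjInd G u) fun v w h => hG.adjInd_mul_eq_zero u h]
  rw [avg_one_sub hp, avg_one_sub hq] at h1
  unfold ndeg
  linarith

/-- Only degrees `d ≥ 1/2` contribute positively to the sum of `d² - d/2`, and there are at most two
of them. One contributes at most 1/2; two have product below 1/2, and then the extreme case is `1`
and `1/2`, again giving 1/2. -/
theorem sum_ndeg_sq_le (hG : TriangleFree G) (J : Finset ι) (μ : ι → V → ℝ)
    (hμ : ∀ k, IsProb (μ k)) (hα : ∀ k l, k ≠ l → 1 / 2 < pairDensity G (μ k) (μ l)) (u : V) :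
    ∑ k ∈ J, ndeg G (μ k) u ^ 2 ≤ (∑ k ∈ J, ndeg G (μ k) u) / 2 + 1 / 2 := by
  set d : ι → ℝ := fun k => ndeg G (μ k) u with hd
  have hd0 : ∀ k, 0 ≤ d k := fun k => ndeg_nonneg (hμ k) u
  have hd1 : ∀ k, d k ≤ 1 := fun k => ndeg_le_one (hμ k) u
  have key : ∑ k ∈ J, (d k ^ 2 - d k / 2) ≤ 1 / 2 := by
    rw [← Finset.sum_filter_add_sum_filter_not J (fun k => 1 / 2 ≤ d k)]
    have hneg : ∑ k ∈ J.filter (fun k => ¬ 1 / 2 ≤ d k), (d k ^ 2 - d k / 2) ≤ 0 := by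
      refine Finset.sum_nonpos fun k hk => ?_
      have := not_le.1 (Finset.mem_filter.1 hk).2
      nlinarith [hd0 k]
    have hpos : ∑ k ∈ J.filter (fun k => 1 / 2 ≤ d k), (d k ^ 2 - d k / 2) ≤ 1 / 2 := by
      have hcard := card_half_le_ndeg hG J μ hμ hα u
      have hmem : ∀ k ∈ J.filter (fun k => 1 / 2 ≤ d k), 1 / 2 ≤ d k :=
        fun k hk => (Finset.mem_filter.1 hk).2
      change (J.filter (fun k => 1 / 2 ≤ d k)).card ≤ 2 at hcard
      generalize J.filter (fun k => 1 / 2 ≤ d k) = P at hcard hmem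
      interval_cases hP : P.card
      · rw [Finset.card_eq_zero.1 hP]; norm_num
      · obtain ⟨k, rfl⟩ := Finset.card_eq_one.1 hP
        rw [Finset.sum_singleton]
        nlinarith [hd0 k, hd1 k]
      · obtain ⟨k, l, hkl, rfl⟩ := Finset.card_eq_two.1 hP
        rw [Finset.sum_pair hkl]
        have h1 := hmem k (by simp)
        have h2 := hmem l (by simp)
        have h3 : d k * d l < 1 / 2 := by
          linarith [hα k l hkl, pairDensity_le_one_sub hG (hμ k) (hμ l) u]
        nlinarith [hd1 k, hd1 l, mul_nonneg (sub_nonneg.2 (hd1 k)) (sub_nonneg.2 (hd1 l)),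
          mul_nonneg (sub_nonneg.2 h1) (sub_nonneg.2 h2)]
    linarith
  rw [Finset.sum_sub_distrib, ← Finset.sum_div] at key
  linarith

end Neighbourhoods

/-! ### Averaging over edges. -/

section GoodEdge

variable {V : Type*} [Fintype V] {G : SimpleGraph V} {ι : Type*} [DecidableEq ι]

/-- Among twelve parts with pairwise densities above `1 / 2` in a triangle-free graph, some edge
almost dominates the other ten parts. -/
theorem exists_adj_sum_lt [Fintype ι] (hι : Fintype.card ι = 12) (hG : TriangleFree G)
    (μ : ι → V → ℝ) (hμ : ∀ k, IsProb (μ k))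
    (hα : ∀ k l, k ≠ l → 1 / 2 < pairDensity G (μ k) (μ l)) :
    ∃ i j u v, i ≠ j ∧ G.Adj u v ∧
      ∑ k ∈ (Finset.univ.erase i).erase j, (1 - ndeg G (μ k) u - ndeg G (μ k) v) < 2 / 11 := by
  by_contra! hcon
  set d : ι → V → ℝ := fun k u => ndeg G (μ k) u with hd
  set T : ι → ι → Finset ι := fun i j => (Finset.univ.erase i).erase j with hT
  have hTc : ∀ i j, T i j = T j i := fun i j => Finset.erase_right_comm
  have hcard : ∀ i j, i ≠ j → (T i j).card = 10 := by
    intro i j hij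
    rw [hT, Finset.card_erase_of_mem (by simp [hij.symm]), Finset.card_erase_of_mem (by simp),
      Finset.card_univ, hι]
  -- `54/11` is half of `10 - 2/11`: the negated claim bounds the degree sums of `u` and `v`
  -- together by `108/11`, so `H i j + H j i` is an average of nonnegative terms over edges.
  set H : ι → ι → ℝ := fun i j =>
    avg (μ i) (fun u => d j u * (54 / 11 - ∑ k ∈ T i j, d k u)) with hH
  have hpair : ∀ i j, i ≠ j → 0 ≤ H i j + H j i := by
    intro i j hij
    have e1 : H i j = avg (μ i) fun u => avg (μ j) fun v =>
        adjInd G u v * (54 / 11 - ∑ k ∈ T i j, d k u) := by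
      simp only [hH, avg_mul_const]; rfl
    have e2 : H j i = avg (μ i) fun u => avg (μ j) fun v =>
        adjInd G u v * (54 / 11 - ∑ k ∈ T i j, d k v) := by
      rw [avg_comm]
      simp only [avg_mul_const, hH, hTc j i, adjInd_comm G _ _]
      rfl
    rw [e1, e2, ← avg_add]
    refine avg_nonneg (hμ i) fun u => ?_
    rw [← avg_add]
    refine avg_nonneg (hμ j) fun v => ?_
    by_cases huv : G.Adj u v
    · have := hcon i j u v hij huv
      rw [Finset.sum_sub_distrib, Finset.sum_sub_distrib, Finset.sum_const, hcard i j hij] at this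
      rw [adjInd_of_adj G huv]
      simp only [hd, nsmul_eq_mul] at this ⊢
      norm_num at this
      linarith
    · simp [adjInd_of_not_adj G huv]
  have hsum : 0 ≤ ∑ i, ∑ j ∈ Finset.univ.erase i, H i j := by
    have h2 : 0 ≤ ∑ i, ∑ j ∈ Finset.univ.erase i, (H i j + H j i) :=
      Finset.sum_nonneg fun i _ => Finset.sum_nonneg fun j hj =>
        hpair i j (Finset.ne_of_mem_erase hj).symm
    simp only [Finset.sum_add_distrib] at h2
    rw [← sum_pairs_swap Finset.univ H] at h2
    linarith
  refine absurd hsum (not_le.2 (Finset.sum_neg (fun i _ => ?_) ?_))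
  · rw [← avg_sum]
    have hle : avg (μ i) (fun u => ∑ j ∈ Finset.univ.erase i,
        d j u * (54 / 11 - ∑ k ∈ T i j, d k u))
        -- The second-moment bound leaves a concave quadratic in the degree sum, replaced by its
        -- tangent at `11/2`. The value 2/11 is what makes the tangent vanish there, while the mean
        -- degree sum exceeds `11/2`.
        ≤ avg (μ i) (fun u => 123 / 4 - 123 / 22 * ∑ j ∈ Finset.univ.erase i, d j u) := by
      refine avg_mono (hμ i) fun u => ?_
      have hQ := sum_ndeg_sq_le hG (Finset.univ.erase i) μ hμ hα u
      have e : ∑ j ∈ Finset.univ.erase i, d j u * (54 / 11 - ∑ k ∈ T i j, d k u)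
          = 54 / 11 * ∑ j ∈ Finset.univ.erase i, d j u
            - (∑ j ∈ Finset.univ.erase i, d j u) ^ 2
            + ∑ j ∈ Finset.univ.erase i, d j u ^ 2 := by
        rw [sq, Finset.mul_sum, Finset.sum_mul, ← Finset.sum_sub_distrib,
          ← Finset.sum_add_distrib]
        refine Finset.sum_congr rfl fun j hj => ?_
        have := Finset.add_sum_erase _ (fun k => d k u) hj
        simp only [hT]
        rw [← this]; ring
      rw [e]
      simp only [hd] at hQ ⊢
      nlinarith [sq_nonneg (∑ j ∈ Finset.univ.erase i, ndeg G (μ j) u - 11 / 2)]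
    refine hle.trans_lt ?_
    rw [avg_sub, avg_const (hμ i), avg_const_mul, avg_sum]
    have hS : 11 / 2 < ∑ j ∈ Finset.univ.erase i, avg (μ i) (d j) := by
      calc (11 / 2 : ℝ) = ∑ j ∈ Finset.univ.erase i, (1 / 2 : ℝ) := by
            rw [Finset.sum_const, Finset.card_erase_of_mem (by simp), Finset.card_univ, hι]
            norm_num
        _ < _ := by
            refine Finset.sum_lt_sum_of_nonempty (Finset.card_pos.1 ?_) fun j hj => ?_
            · rw [Finset.card_erase_of_mem (by simp), Finset.card_univ, hι]; norm_num
            · have := hα i j (Finset.ne_of_mem_erase hj).symm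
              rwa [pairDensity_eq_avg_ndeg] at this
    linarith
  · rw [← Finset.card_pos, Finset.card_univ, hι]; norm_num

end GoodEdge

/-! ### Few edges are missing between two nearly exhausting independent sets. -/

section MissingEdges

variable {V : Type*} [Fintype V] {G : SimpleGraph V} {p q s A C : V → ℝ}

/-- Two neighbours of `w` are never adjacent, so each pair of them counts as missing. -/
theorem wdeg_mul_wdeg_le_wmiss (hG : TriangleFree G) (hp : IsProb p) (hq : IsProb q)
    (hA : ∀ v, 0 ≤ A v) (hC : ∀ v, 0 ≤ C v) (w : V) :
    wdeg G p A w * wdeg G q C w ≤ wmiss G p q A C := by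
  rw [wdeg, ← avg_mul_const]
  refine avg_mono hp fun u => ?_
  rw [mul_assoc]
  refine mul_le_mul_of_nonneg_left ?_ (hA u)
  rw [wdeg, ← avg_const_mul]
  refine avg_mono hq fun v => ?_
  rw [mul_left_comm]
  refine mul_le_mul_of_nonneg_left ?_ (hC v)
  by_cases huv : G.Adj u v
  · rw [hG.adjInd_mul_eq_zero w huv]
    linarith [adjInd_le_one G u v]
  · rw [adjInd_of_not_adj G huv]
    nlinarith [adjInd_le_one G w u, adjInd_le_one G w v, adjInd_nonneg G w u, adjInd_nonneg G w v]

/-- Split both sides into `A`, `C` and the rest: the `A`–`A` and `C`–`C` terms vanish, and the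
rest–rest term is at most the product of the weights. -/
theorem pairDensity_le_add (hp : IsProb p) (hq : IsProb q)
    (hAC : ∀ v, A v + C v ≤ 1) (hAi : ∀ u v, G.Adj u v → A u * A v = 0)
    (hCi : ∀ u v, G.Adj u v → C u * C v = 0) :
    pairDensity G p q ≤ avg p A * avg q C + avg q A * avg p C
      - wmiss G p q A C - wmiss G q p A C
      + avg p (fun v => (1 - A v - C v) * (wdeg G q A v + wdeg G q C v))
      + avg q (fun v => (1 - A v - C v) * (wdeg G p A v + wdeg G p C v))
      + avg p (fun v => 1 - A v - C v) * avg q (fun v => 1 - A v - C v) := by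
  set R : V → ℝ := fun v => 1 - A v - C v with hR
  have hR0 : ∀ v, 0 ≤ R v := fun v => by simp only [hR]; linarith [hAC v]
  have h1 : pairDensity G p q
      = wedge G p q (fun v => A v + (C v + R v)) (fun v => A v + (C v + R v)) := by
    simp [pairDensity, hR]
  have h2 := wedge_le (G := G) hp hq hR0 hR0
  have h3 : avg p (fun v => R v * (wdeg G q A v + wdeg G q C v))
      = wedge G p q R A + wedge G p q R C := by simp only [mul_add, avg_add]; rfl
  have h4 : avg q (fun v => R v * (wdeg G p A v + wdeg G p C v))
      = wedge G p q A R + wedge G p q C R := by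
    rw [wedge_comm A R, wedge_comm C R]; simp only [mul_add, avg_add]; rfl
  change _ ≤ _ - wmiss G p q A C - wmiss G q p A C
      + avg p (fun v => R v * (wdeg G q A v + wdeg G q C v))
      + avg q (fun v => R v * (wdeg G p A v + wdeg G p C v)) + avg p R * avg q R
  rw [h1, h3, h4, wmiss_comm (p := q), wmiss_eq, wmiss_eq]
  simp only [wedge_add_left, wedge_add_right]
  rw [wedge_eq_zero hAi, wedge_eq_zero hCi]
  linarith

/-- Two disjoint independent weight functions that nearly exhaust three parts miss few of the
edges between them. -/
theorem wmiss_le_of_triple (hG : TriangleFree G) (hp : IsProb p) (hq : IsProb q) (hs : IsProb s)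
    (hA : ∀ v, 0 ≤ A v) (hC : ∀ v, 0 ≤ C v) (hAC : ∀ v, A v + C v ≤ 1)
    (hAi : ∀ u v, G.Adj u v → A u * A v = 0) (hCi : ∀ u v, G.Adj u v → C u * C v = 0)
    (hpA : avg p A ≤ 1 / 2) (hpC : avg p C ≤ 1 / 2) (hqA : avg q A ≤ 1 / 2)
    (hqC : avg q C ≤ 1 / 2) (hsA : avg s A ≤ 1 / 2) (hsC : avg s C ≤ 1 / 2)
    (hpq : 1 / 2 < pairDensity G p q) (hps : 1 / 2 < pairDensity G p s)
    (hqs : 1 / 2 < pairDensity G q s)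
    (hr : (1 - avg p A - avg p C) + (1 - avg q A - avg q C) + (1 - avg s A - avg s C) ≤ 2 / 11) :
    wmiss G p q A C ≤ 8 / 231 := by
  have hR0 : ∀ v, 0 ≤ 1 - A v - C v := fun v => by linarith [hAC v]
  have hr' : ∀ {p : V → ℝ}, IsProb p → avg p (fun v => 1 - A v - C v) = 1 - avg p A - avg p C :=
    fun hp => by rw [avg_sub, avg_one_sub hp]
  set M := wmiss G p q A C + wmiss G q p A C + wmiss G p s A C + wmiss G s p A C
    + wmiss G q s A C + wmiss G s q A C with hM
  have m1 := wmiss_nonneg (G := G) hp hq hA hC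
  have m2 := wmiss_nonneg (G := G) hq hp hA hC
  have m3 := wmiss_nonneg (G := G) hp hs hA hC
  have m4 := wmiss_nonneg (G := G) hs hp hA hC
  have m5 := wmiss_nonneg (G := G) hq hs hA hC
  have m6 := wmiss_nonneg (G := G) hs hq hA hC
  -- Degrees `x, y ≤ 1/2` into `A` of one part and `C` of the other satisfy `x + y ≤ 1/2 + 2xy`, and
  -- `xy` is paid for by missing edges.
  have hdeg : ∀ {p q s : V → ℝ}, IsProb p → IsProb q → IsProb s → avg q A ≤ 1 / 2 →
      avg q C ≤ 1 / 2 → avg s A ≤ 1 / 2 → avg s C ≤ 1 / 2 →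
      wmiss G q s A C + wmiss G s q A C ≤ M →
      avg p (fun v => (1 - A v - C v) * (wdeg G q A v + wdeg G q C v))
        + avg p (fun v => (1 - A v - C v) * (wdeg G s A v + wdeg G s C v))
        ≤ (1 - avg p A - avg p C) * (1 + 2 * M) := by
    intro p q s hp hq hs hqA hqC hsA hsC hle
    rw [← hr' hp, ← avg_add, ← avg_mul_const]
    refine avg_mono hp fun v => ?_
    rw [← mul_add]
    refine mul_le_mul_of_nonneg_left ?_ (hR0 v)
    have o1 := wdeg_mul_wdeg_le_wmiss hG hq hs hA hC v
    have o2 := wdeg_mul_wdeg_le_wmiss hG hs hq hA hC v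
    have d1 := (wdeg_le (G := G) hq hA v).trans hqA
    have d2 := (wdeg_le (G := G) hq hC v).trans hqC
    have d3 := (wdeg_le (G := G) hs hA v).trans hsA
    have d4 := (wdeg_le (G := G) hs hC v).trans hsC
    linarith [mul_nonneg (sub_nonneg.2 d1) (sub_nonneg.2 d4),
      mul_nonneg (sub_nonneg.2 d3) (sub_nonneg.2 d2)]
  have b1 := pairDensity_le_add hp hq hAC hAi hCi
  have b2 := pairDensity_le_add hp hs hAC hAi hCi
  have b3 := pairDensity_le_add hq hs hAC hAi hCi
  have c1 := hdeg hp hq hs hqA hqC hsA hsC (by linarith)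
  have c2 := hdeg hq hp hs hpA hpC hsA hsC (by linarith)
  have c3 := hdeg hs hp hq hpA hpC hqA hqC (by linarith)
  have r0 : ∀ {p : V → ℝ}, IsProb p → 0 ≤ 1 - avg p A - avg p C := fun hp => by
    rw [← hr' hp]; exact avg_nonneg hp hR0
  have rp := r0 hp
  have rq := r0 hq
  have rs := r0 hs
  rw [hr' hp, hr' hq] at b1
  rw [hr' hp, hr' hs] at b2
  rw [hr' hq, hr' hs] at b3
  have hcross : ∀ {a c a' c' : ℝ}, a ≤ 1 / 2 → c ≤ 1 / 2 → a' ≤ 1 / 2 → c' ≤ 1 / 2 →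
      a * c' + a' * c ≤ 1 / 2 - ((1 - a - c) + (1 - a' - c')) / 2
        + (1 - a - c) * (1 - a' - c') := fun {a c a' c'} h1 h2 h3 h4 => by
    nlinarith [mul_nonneg (sub_nonneg.2 h1) (sub_nonneg.2 h3),
      mul_nonneg (sub_nonneg.2 h2) (sub_nonneg.2 h4)]
  have x1 := hcross hpA hpC hqA hqC
  have x2 := hcross hpA hpC hsA hsC
  have x3 := hcross hqA hqC hsA hsC
  have hM0 : 0 ≤ M := by linarith only [hM, m1, m2, m3, m4, m5, m6]
  have s1 := hpq.trans_le (b1.trans (add_le_add_left (add_le_add_left (add_le_add_left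
    (sub_le_sub_right (sub_le_sub_right x1 _) _) _) _) _))
  have s2 := hps.trans_le (b2.trans (add_le_add_left (add_le_add_left (add_le_add_left
    (sub_le_sub_right (sub_le_sub_right x2 _) _) _) _) _))
  have s3 := hqs.trans_le (b3.trans (add_le_add_left (add_le_add_left (add_le_add_left
    (sub_le_sub_right (sub_le_sub_right x3 _) _) _) _) _))
  clear b1 b2 b3 x1 x2 x3 hdeg hcross r0 hr'
  generalize hP : 1 - avg p A - avg p C = P at *
  generalize hQ : 1 - avg q A - avg q C = Q at *
  generalize hS : 1 - avg s A - avg s C = S at *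
  -- On adding the three density bounds, the terms linear in `P + Q + S` cancel. What remains is
  -- second order, at most `2 · (2/11)²/3`, and dividing by `1 - 4/11` gives `8/231`.
  have key : M * (1 - 2 * (P + Q + S)) ≤ 2 * (P * Q + P * S + Q * S) := by
    linarith only [s1, s2, s3, c1, c2, c3, hM]
  have hPQS : P * Q + P * S + Q * S ≤ 4 / 363 := by
    nlinarith only [sq_nonneg (P - Q), sq_nonneg (P - S), sq_nonneg (Q - S), hr, rp, rq, rs]
  have : M * (7 / 11) ≤ M * (1 - 2 * (P + Q + S)) :=
    mul_le_mul_of_nonneg_left (by linarith only [hr]) hM0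
  linarith only [this, key, hPQS, hM, m1, m2, m3, m4, m5, m6]

end MissingEdges

/-! ### Completing the two neighbourhoods to a cut. -/

section Endgame

variable {V : Type*} [Fintype V] {G : SimpleGraph V} {ι : Type*} [DecidableEq ι]

theorem wdeg_le_wdeg_add {q f h : V → ℝ} (hq : IsProb q) (hfh : ∀ v, f v ≤ h v) (w : V) :
    wdeg G q h w ≤ wdeg G q f w + (avg q h - avg q f) := by
  have h1 : wdeg G q h w = wdeg G q f w + wdeg G q (fun v => h v - f v) w := by
    rw [← wdeg_add]; simp
  have h2 := wdeg_le (G := G) hq (f := fun v => h v - f v) (fun v => sub_nonneg.2 (hfh v)) w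
  rw [avg_sub] at h2
  linarith

theorem wdeg_eq_zero {q f : V → ℝ} {w : V} (hw : f w = 1)
    (hf : ∀ u v, G.Adj u v → f u * f v = 0) : wdeg G q f w = 0 := by
  simp only [wdeg, avg]
  refine Finset.sum_eq_zero fun v _ => ?_
  by_cases h : G.Adj w v
  · have := hf w v h
    rw [hw, one_mul] at this
    rw [this]; ring
  · rw [adjInd_of_not_adj G h]; ring

/-- Six parts with pairwise densities above `1 / 2` in a triangle-free graph cannot be nearly
exhausted by two disjoint independent sets that have weight less than `1 / 2` on each part. -/
theorem two_div_eleven_lt_sum (hG : TriangleFree G) (μ : ι → V → ℝ) (hμ : ∀ k, IsProb (μ k))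
    (hα : ∀ k l, k ≠ l → 1 / 2 < pairDensity G (μ k) (μ l)) (A C : V → ℝ)
    (hA01 : ∀ v, A v = 0 ∨ A v = 1) (hC01 : ∀ v, C v = 0 ∨ C v = 1) (hAC : ∀ v, A v + C v ≤ 1)
    (hAi : ∀ u v, G.Adj u v → A u * A v = 0) (hCi : ∀ u v, G.Adj u v → C u * C v = 0)
    (Z : Finset ι) (hZ : 6 ≤ Z.card) (hZA : ∀ k ∈ Z, avg (μ k) A < 1 / 2)
    (hZC : ∀ k ∈ Z, avg (μ k) C < 1 / 2) :
    2 / 11 < ∑ k ∈ Z, (1 - avg (μ k) A - avg (μ k) C) := by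
  classical
  by_contra! hρ
  have hA0 : ∀ v, 0 ≤ A v := fun v => by rcases hA01 v with h | h <;> simp [h]
  have hC0 : ∀ v, 0 ≤ C v := fun v => by rcases hC01 v with h | h <;> simp [h]
  set r : ι → ℝ := fun k => 1 - avg (μ k) A - avg (μ k) C with hr
  have hr0 : ∀ k, 0 ≤ r k := fun k => by
    have : r k = avg (μ k) (fun v => 1 - A v - C v) := by
      rw [avg_sub, avg_one_sub (hμ k)]
    rw [this]; exact avg_nonneg (hμ k) fun v => by linarith [hAC v]
  have hrsub : ∀ S ⊆ Z, ∑ k ∈ S, r k ≤ 2 / 11 := fun S hS =>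
    (Finset.sum_le_sum_of_subset_of_nonneg hS fun k _ _ => hr0 k).trans hρ
  have hr2 : ∀ k ∈ Z, ∀ l ∈ Z, k ≠ l → r k + r l ≤ 2 / 11 := fun k hk l hl hkl => by
    have := hrsub {k, l} (by simp [Finset.insert_subset_iff, hk, hl])
    rwa [Finset.sum_pair hkl] at this
  have hmiss : ∀ k ∈ Z, ∀ l ∈ Z, ∀ m ∈ Z, k ≠ l → k ≠ m → l ≠ m →
      wmiss G (μ k) (μ l) A C ≤ 8 / 231 := by
    intro k hk l hl m hm hkl hkm hlm
    have h3 := hrsub {k, l, m} (by simp [Finset.insert_subset_iff, hk, hl, hm])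
    rw [Finset.sum_insert (by simp [hkl, hkm]), Finset.sum_pair hlm, ← add_assoc] at h3
    exact wmiss_le_of_triple hG (hμ k) (hμ l) (hμ m) hA0 hC0 hAC hAi hCi (hZA k hk).le
      (hZC k hk).le (hZA l hl).le (hZC l hl).le (hZA m hm).le (hZC m hm).le (hα k l hkl)
      (hα k m hkm) (hα l m hlm) h3
  -- Leftover vertices with small degree into `C` join `C` to form `y`; the others join `A`. The
  -- threshold `7/22 = 1/2 - 2/11` is the most that the first case below can afford.
  set L : ι → V → Prop := fun k w => ∀ l ∈ Z, l ≠ k → wdeg G (μ l) C w ≤ 7 / 22 with hL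
  set y : ι → V → ℝ := fun k w => if A w = 0 ∧ L k w then 1 else 0 with hy
  have hy0 : ∀ k w, 0 ≤ y k w := fun k w => by simp only [hy]; split_ifs <;> norm_num
  have hy1 : ∀ k w, y k w ≤ 1 := fun k w => by simp only [hy]; split_ifs <;> norm_num
  have hLC : ∀ k w, C w = 1 → A w = 0 ∧ L k w := by
    intro k w hw
    refine ⟨le_antisymm (by linarith [hAC w]) (hA0 w), fun l _ _ => ?_⟩
    rw [wdeg_eq_zero hw hCi]; norm_num
  have hCy : ∀ k w, C w ≤ y k w := by
    intro k w
    rcases hC01 w with h | h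
    · rw [h]; exact hy0 k w
    · simp only [hy]; rw [if_pos (hLC k w h), h]
  have hAx : ∀ k w, A w ≤ 1 - y k w := by
    intro k w
    rcases hA01 w with h | h
    · rw [h]; exact sub_nonneg.2 (hy1 k w)
    · simp only [hy]; rw [if_neg (by simp [h]), h]; norm_num
  have hx : ∀ k, avg (μ k) (fun w => 1 - y k w) = 1 - avg (μ k) (y k) :=
    fun k => avg_one_sub (hμ k) _
  have hcard := Finset.card_filter_add_card_filter_not (s := Z)
    (fun k => 1 / 2 ≤ avg (μ k) (y k))
  rcases Nat.lt_or_ge 2 (Z.filter fun k => 1 / 2 ≤ avg (μ k) (y k)).card with h3 | h3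
  · obtain ⟨K, hKs, hK⟩ := Finset.exists_subset_card_eq (n := 3) h3
    have hKZ : ∀ k ∈ K, k ∈ Z := fun k hk => (Finset.mem_filter.1 (hKs hk)).1
    have hKy : ∀ k ∈ K, 1 / 2 ≤ avg (μ k) (y k) := fun k hk => (Finset.mem_filter.1 (hKs hk)).2
    have ha : ∀ k ∈ K, 0 < avg (μ k) A := by
      intro k hk
      have h1 := Finset.single_le_sum (f := r) (fun k _ => hr0 k) (hKZ k hk)
      have h2 := hZC k (hKZ k hk)
      simp only [hr] at h1 hρ
      linarith
    refine not_sum_pairs_le_half K (by omega) (fun k l => pairDensity G (μ k) (μ l))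
      (fun k _ l _ => hα k l) ?_
    -- Three parts where the side of `A` is the lighter one: edges inside `y` are charged only to
    -- non-edges at `A`, which has positive weight on each part.
    refine sum_pairDensity_le_of_cut hG K μ hμ (fun k w => 1 - y k w) (fun _ => A)
      (fun k w => sub_nonneg.2 (hy1 k w)) (fun k w => by linarith [hy0 k w]) (fun _ => hA0)
      (fun k hk => by rw [hx]; linarith [hKy k hk]) 2 (by norm_num)
      (fun k l => (∑ m ∈ (K.erase k).erase l, avg (μ m) A)⁻¹)
      (fun k l => inv_nonneg.2 (Finset.sum_nonneg fun m _ => avg_nonneg (hμ m) hA0))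
      (fun k l => by rw [Finset.erase_right_comm]) ?_ ?_ ?_
    · intro k hk l hl hkl
      obtain ⟨m, hm, hkm, hlm⟩ := exists_third hK hk hl hkl
      rw [sum_erase_erase_of_card_three hK hk hl hm hkl hkm hlm]
      simp only [sub_sub_cancel]
      linarith [hKy m hm]
    · intro k hk l hl hkl
      obtain ⟨m, hm, hkm, hlm⟩ := exists_third hK hk hl hkl
      right
      rw [sum_erase_erase_of_card_three hK hk hl hm hkl hkm hlm, inv_mul_cancel₀ (ha m hm).ne']
    · intro k hk m hm hkm u t ht
      obtain ⟨l, hl, hkl, hml⟩ := exists_third hK hk hm hkm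
      rw [sum_erase_erase_of_card_three hK hk hm hl hkm hkl hml,
        sum_erase_erase_of_card_three hK hk hm hl hkm hkl hml,
        sum_erase_erase_of_card_three hK hm hl hk hml hkm.symm hkl.symm]
      simp only [sub_sub_cancel]
      rcases hA01 u with hu | hu
      · rw [hu, zero_mul, add_zero]
        refine mul_le_of_le_one_right (sub_nonneg.2 (hy1 k u)) ?_
        have := wdeg_le (G := G) (hμ l) (f := fun v => 1 - y l v)
          (fun v => sub_nonneg.2 (hy1 l v)) u
        rw [hx] at this
        linarith [hKy l hl]
      · have hyu : y k u = 0 := le_antisymm (by linarith [hAx k u]) (hy0 k u)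
        have hLt : L m t := by
          by_contra hn
          exact ht (by simp [hy, hn])
        have e1 := wdeg_le_wdeg_add (G := G) (hμ l) (hAx l) u
        rw [wdeg_eq_zero hu hAi, hx] at e1
        have e2 := wdeg_le_wdeg_add (G := G) (hμ l) (hCy l) t
        have e3 := hLt l (hKZ l hl) hml.symm
        have e4 := avg_mono (hμ l) (hAx l)
        rw [hx] at e4
        have e6 := hr2 k (hKZ k hk) l (hKZ l hl) hkl
        have e7 := hZA k (hKZ k hk)
        have e8 := hZC k (hKZ k hk)
        have e9 := ha k hk
        simp only [hr] at e6
        rw [hyu, hu, sub_zero, one_mul, one_mul, inv_mul_eq_div]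
        -- After clearing the denominator this needs `7/22` plus the leftover weights of `k` and `l`
        -- to be at most 1/2, using that `A` weighs more than 1/2 minus the leftover on `k`.
        have e10 : wdeg G (μ l) (y l) t / avg (μ k) A
            ≤ 1 - 2 * (1 - avg (μ l) (y l) - avg (μ l) A) := by
          rw [div_le_iff₀ e9]
          nlinarith
        linarith
  · have h4 : 4 ≤ (Z.filter fun k => ¬ 1 / 2 ≤ avg (μ k) (y k)).card := by omega
    obtain ⟨K, hKs, hK⟩ := Finset.exists_subset_card_eq (n := 4) h4
    have hKZ : ∀ k ∈ K, k ∈ Z := fun k hk => (Finset.mem_filter.1 (hKs hk)).1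
    have hKy : ∀ k ∈ K, avg (μ k) (y k) < 1 / 2 :=
      fun k hk => not_le.1 (Finset.mem_filter.1 (hKs hk)).2
    have hT : ∀ k ∈ K, ∀ l ∈ K, k ≠ l → ∃ m ∈ K, ∃ n ∈ K, m ≠ n ∧ k ≠ m ∧ k ≠ n ∧ l ≠ m ∧ l ≠ n ∧
        (K.erase k).erase l = {m, n} := by
      intro k hk l hl hkl
      have h1 : ((K.erase k).erase l).card = 2 := by
        rw [Finset.card_erase_of_mem (by simp [*, hkl.symm]), Finset.card_erase_of_mem hk, hK]
      obtain ⟨m, n, hmn, h⟩ := Finset.card_eq_two.1 h1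
      have hm : m ∈ (K.erase k).erase l := by simp [h]
      have hn : n ∈ (K.erase k).erase l := by simp [h]
      simp only [Finset.mem_erase] at hm hn
      exact ⟨m, hm.2.2, n, hn.2.2, hmn, hm.2.1.symm, hn.2.1.symm, hm.1.symm, hn.1.symm, h⟩
    refine not_sum_pairs_le_half K (by omega) (fun k l => pairDensity G (μ k) (μ l))
      (fun k _ l _ => hα k l) ?_
    -- Four parts where `y` is the lighter side. Two third parts have outer weight above 1, allowing
    -- rate 1, and `C`-weight above `1 - 2/11 = 9/11`, allowing rate `11/9`.
    refine sum_pairDensity_le_of_cut hG K μ hμ y (fun _ => C) hy0 hy1 (fun _ => hC0)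
      (fun k hk => (hKy k hk).le) 1 (by norm_num) (fun _ _ => 11 / 9)
      (fun _ _ => by norm_num) (fun _ _ => rfl) ?_ ?_ ?_
    · intro k hk l hl hkl
      obtain ⟨m, hm, n, hn, hmn, -, -, -, -, h⟩ := hT k hk l hl hkl
      rw [h, Finset.sum_pair hmn, hx, hx]
      linarith [hKy m hm, hKy n hn]
    · intro k hk l hl hkl
      obtain ⟨m, hm, n, hn, hmn, -, -, -, -, h⟩ := hT k hk l hl hkl
      right
      rw [h, Finset.sum_pair hmn]
      have := hr2 m (hKZ m hm) n (hKZ n hn) hmn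
      simp only [hr] at this
      linarith [hZA m (hKZ m hm), hZA n (hKZ n hn)]
    · intro k hk m hm hkm u t ht
      obtain ⟨l, hl, n, hn, hln, hkl, hkn, hml, hmn, h⟩ := hT k hk m hm hkm
      rw [h, Finset.sum_pair hln, Finset.sum_pair hln]
      rcases hC01 u with hu | hu
      · rw [hu, zero_mul, add_zero]
        refine mul_le_of_le_one_right (hy0 k u) ?_
        have h1 := wdeg_le (G := G) (hμ l) (hy0 l) u
        have h2 := wdeg_le (G := G) (hμ n) (hy0 n) u
        linarith [hKy l hl, hKy n hn]
      · have hyu : y k u = 1 := by simp only [hy]; rw [if_pos (hLC k u hu)]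
        have hyC : ∀ l, wdeg G (μ l) (y l) u ≤ avg (μ l) (y l) - avg (μ l) C := fun l => by
          have := wdeg_le_wdeg_add (G := G) (hμ l) (hCy l) u
          rwa [wdeg_eq_zero hu hCi, zero_add] at this
        have hxA : ∀ l, wdeg G (μ l) (fun v => 1 - y l v) t
            ≤ wdeg G (μ l) A t + (1 - avg (μ l) (y l) - avg (μ l) A) := fun l => by
          have := wdeg_le_wdeg_add (G := G) (hμ l) (hAx l) t
          rwa [hx] at this
        have hCyl : ∀ l, avg (μ l) C ≤ avg (μ l) (y l) := fun l => avg_mono (hμ l) (hCy l)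
        -- If `t` is outside `A`, it has degree above `7/22` into `C` on some part `o`, so missing
        -- edges limit its degree into `A` on any further part to `(8/231)/(7/22) = 16/147`; only
        -- one of `l`, `n` can be `o`. The charge then totals at most `(11/9)(7/11 + 2/11) = 1`.
        have hdegA : wdeg G (μ l) A t + wdeg G (μ n) A t ≤ 7 / 11 := by
          rcases hA01 t with htA | htA
          · have hLt : ¬ L m t := fun hn => ht (by simp [hy, hn, htA])
            simp only [hL, not_forall, not_le] at hLt
            obtain ⟨o, hoZ, hom, ho⟩ := hLt
            have hsmall : ∀ l ∈ Z, l ≠ m → l ≠ o → wdeg G (μ l) A t ≤ 16 / 147 := by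
              intro l hl hlm hlo
              have h1 := wdeg_mul_wdeg_le_wmiss hG (hμ l) (hμ o) hA0 hC0 t
              have h2 := hmiss l hl o hoZ m (hKZ m hm) hlo hlm hom
              have h3 := wdeg_nonneg (G := G) (hμ l) hA0 t
              nlinarith
            have hl1 := (wdeg_le (G := G) (hμ l) hA0 t).trans (hZA l (hKZ l hl)).le
            have hn1 := (wdeg_le (G := G) (hμ n) hA0 t).trans (hZA n (hKZ n hn)).le
            by_cases hlo : l = o
            · have := hsmall n (hKZ n hn) hmn.symm (fun h => hln (hlo.trans h.symm))
              linarith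
            · have := hsmall l (hKZ l hl) hml.symm hlo
              linarith
          · rw [wdeg_eq_zero htA hAi, wdeg_eq_zero htA hAi]; norm_num
        have e6 := hr2 l (hKZ l hl) n (hKZ n hn) hln
        simp only [hr] at e6
        rw [hu, hyu]
        linarith [hyC l, hyC n, hxA l, hxA n, hCyl l, hCyl n]

/-- Twelve probability vectors on the vertices of a triangle-free graph do not all have pairwise
edge density above `1 / 2`. -/
theorem exists_pairDensity_le_half [Fintype ι] (hι : Fintype.card ι = 12) (hG : TriangleFree G)
    (μ : ι → V → ℝ) (hμ : ∀ k, IsProb (μ k)) :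
    ∃ k l, k ≠ l ∧ pairDensity G (μ k) (μ l) ≤ 1 / 2 := by
  by_contra! hα
  obtain ⟨i, j, u, v, hij, huv, hlt⟩ := exists_adj_sum_lt hι hG μ hμ hα
  set J := (Finset.univ.erase i).erase j with hJ
  have hJc : J.card = 10 := by
    rw [hJ, Finset.card_erase_of_mem (by simp [hij.symm]), Finset.card_erase_of_mem (by simp),
      Finset.card_univ, hι]
  have h01 : ∀ w t, adjInd G w t = 0 ∨ adjInd G w t = 1 := fun w t => by
    unfold adjInd; split_ifs <;> simp
  have hAC : ∀ w, adjInd G u w + adjInd G v w ≤ 1 := by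
    intro w
    by_cases hvw : G.Adj v w
    · rw [adjInd_of_not_adj G (hG u v w huv hvw), zero_add]
      exact adjInd_le_one G v w
    · rw [adjInd_of_not_adj G hvw, add_zero]
      exact adjInd_le_one G u w
  -- Each of `u`, `v` spoils at most two of the ten parts, leaving six.
  set Z := (J.filter fun k => ¬ 1 / 2 ≤ ndeg G (μ k) u).filter
    fun k => ¬ 1 / 2 ≤ ndeg G (μ k) v with hZ
  have c1 := card_half_le_ndeg hG J μ hμ hα u
  have c2 := card_half_le_ndeg hG (J.filter fun k => ¬ 1 / 2 ≤ ndeg G (μ k) u) μ hμ hα v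
  have c3 := Finset.card_filter_add_card_filter_not (s := J)
    (fun k => 1 / 2 ≤ ndeg G (μ k) u)
  have c4 := Finset.card_filter_add_card_filter_not
    (s := J.filter fun k => ¬ 1 / 2 ≤ ndeg G (μ k) u) (fun k => 1 / 2 ≤ ndeg G (μ k) v)
  rw [← hZ] at c4
  have hZJ : Z ⊆ J := (Finset.filter_subset _ _).trans (Finset.filter_subset _ _)
  have h := two_div_eleven_lt_sum hG μ hμ hα (adjInd G u) (adjInd G v) (h01 u) (h01 v) hAC
    (fun _ _ => hG.adjInd_mul_eq_zero u) (fun _ _ => hG.adjInd_mul_eq_zero v) Z (by omega)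
    (fun k hk => not_le.1 (Finset.mem_filter.1 (Finset.mem_filter.1 hk).1).2)
    (fun k hk => not_le.1 (Finset.mem_filter.1 hk).2)
  refine absurd (h.trans_le (Finset.sum_le_sum_of_subset_of_nonneg hZJ fun k _ _ => ?_))
    (not_lt.2 hlt.le)
  have := avg_mono (hμ k) hAC
  rw [avg_add, avg_const (hμ k)] at this
  linarith

end Endgame

/-! ### Translation from partite graphs to probability vectors on one vertex set. -/

namespace WeightedPartiteGraph

variable {W : Type*} {H : SimpleGraph W}

theorem sum_sum_weight (G : WeightedPartiteGraph H) (x y : W) :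
    ∑ u : G.V x, ∑ v : G.V y, G.weight ⟨x, u⟩ * G.weight ⟨y, v⟩ = 1 := by
  simp only [← Finset.mul_sum, G.sum_weight, mul_one]

theorem edgeDensity_nonneg (G : WeightedPartiteGraph H) (x y : W) : 0 ≤ G.edgeDensity x y :=
  Finset.sum_nonneg fun u _ => Finset.sum_nonneg fun v _ =>
    mul_nonneg (mul_nonneg (G.weight_mem _).1 (G.weight_mem _).1) (by split_ifs <;> norm_num)

theorem edgeDensity_le_one (G : WeightedPartiteGraph H) (x y : W) : G.edgeDensity x y ≤ 1 := by
  rw [← G.sum_sum_weight x y]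
  refine Finset.sum_le_sum fun u _ => Finset.sum_le_sum fun v _ => ?_
  exact mul_le_of_le_one_right (mul_nonneg (G.weight_mem _).1 (G.weight_mem _).1)
    (by split_ifs <;> norm_num)

theorem density_le_edgeDensity (G : WeightedPartiteGraph H) {x y : W} (h : H.Adj x y) :
    G.density ≤ G.edgeDensity x y :=
  csInf_le ⟨0, by rintro _ ⟨x, y, -, rfl⟩; exact G.edgeDensity_nonneg x y⟩ ⟨x, y, h, rfl⟩

theorem nonempty_V (G : WeightedPartiteGraph H) (x : W) : Nonempty (G.V x) := by
  by_contra h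
  rw [not_nonempty_iff] at h
  simpa using G.sum_weight x

/-- A triangle meets three distinct parts, so some transversal contains it as a 3-cycle. -/
theorem triangleFree_of_hasFreeTransversals [DecidableEq W]
    (G : WeightedPartiteGraph (⊤ : SimpleGraph W)) (hG : G.HasFreeTransversals (oddCycles ⊤)) :
    TriangleFree G.graph := by
  rintro ⟨x, u⟩ ⟨y, v⟩ ⟨z, t⟩ huv hvt hut
  have hxy : x ≠ y := G.adj_host _ _ huv
  have hyz : y ≠ z := G.adj_host _ _ hvt
  have hxz : x ≠ z := G.adj_host _ _ hut
  let f : ∀ x, G.V x := Function.update (Function.update (Function.update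
    (fun x => (G.nonempty_V x).some) x u) y v) z t
  have hfx : f x = u := by simp [f, hxy, hxz]
  have hfy : f y = v := by simp [f, hyz]
  have hfz : f z = t := by simp [f]
  have hinj : Function.Injective ![x, y, z] := by
    intro i j
    fin_cases i <;> fin_cases j <;> simp [hxy, hyz, hxz, hxy.symm, hyz.symm, hxz.symm]
  let c : SimpleGraph.Copy (SimpleGraph.cycleGraph 3) (⊤ : SimpleGraph W) :=
    ⟨⟨![x, y, z], fun {i j} h => hinj.ne h.ne⟩, hinj⟩
  refine hG f c.toSubgraph ⟨3, le_rfl, by decide, ⟨c.isoToSubgraph.symm⟩⟩ ?_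
  rw [SimpleGraph.isContained_congr_left c.isoToSubgraph.symm]
  refine ⟨⟨⟨![x, y, z], fun {i j} h => ?_⟩, hinj⟩⟩
  have hij := h.ne
  simp only [transversal, SimpleGraph.comap_adj]
  fin_cases i <;> fin_cases j <;>
    simp_all [huv.symm, hvt.symm, hut.symm]

/-- The weight vector of the part at `x`, extended by zero to all vertices. -/
noncomputable def partWeight [DecidableEq W] (G : WeightedPartiteGraph H) (x : W)
    (v : Σ x, G.V x) : ℝ :=
  if v.1 = x then G.weight v else 0

variable [Fintype W] [DecidableEq W]

theorem avg_partWeight (G : WeightedPartiteGraph H) (x : W) (f : (Σ x, G.V x) → ℝ) :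
    avg (G.partWeight x) f = ∑ v : G.V x, G.weight ⟨x, v⟩ * f ⟨x, v⟩ := by
  rw [avg, Fintype.sum_sigma, Finset.sum_eq_single x]
  · simp [partWeight]
  · intro y _ hyx
    simp [partWeight, hyx]
  · simp

theorem isProb_partWeight (G : WeightedPartiteGraph H) (x : W) : IsProb (G.partWeight x) := by
  constructor
  · intro v
    unfold partWeight
    split_ifs
    · exact (G.weight_mem v).1
    · exact le_rfl
  · have := G.avg_partWeight x fun _ => 1
    simpa [avg, G.sum_weight] using this

theorem pairDensity_partWeight (G : WeightedPartiteGraph H) (x y : W) :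
    pairDensity G.graph (G.partWeight x) (G.partWeight y) = G.edgeDensity x y := by
  simp only [pairDensity, wedge, wdeg, one_mul, avg_partWeight, edgeDensity, Finset.mul_sum,
    adjInd, mul_assoc]

theorem density_le_half {r : ℕ} (hr : 12 ≤ r)
    (G : WeightedPartiteGraph (⊤ : SimpleGraph (Fin r)))
    (hG : G.HasFreeTransversals (oddCycles ⊤)) : G.density ≤ 1 / 2 := by
  obtain ⟨k, l, hkl, h⟩ := exists_pairDensity_le_half (ι := Fin 12) (by simp)
    (G.triangleFree_of_hasFreeTransversals hG) (fun k => G.partWeight (Fin.castLE hr k))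
    fun k => G.isProb_partWeight _
  rw [pairDensity_partWeight] at h
  exact (G.density_le_edgeDensity fun e => hkl (Fin.castLE_injective hr e)).trans h

end WeightedPartiteGraph

/-! ### The extremal construction and the conclusion. -/

/-- The balanced bipartite graph with two vertices of weight `1 / 2` in each part. -/
noncomputable def balancedBipartite (W : Type*) : WeightedPartiteGraph (⊤ : SimpleGraph W) where
  V _ := Bool
  graph :=
    { Adj := fun u v => u.1 ≠ v.1 ∧ u.2 ≠ v.2
      symm := ⟨fun _ _ h => ⟨h.1.symm, h.2.symm⟩⟩
      loopless := ⟨fun _ h => h.1 rfl⟩ }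
  adj_host _ _ h := h.1
  weight _ := 1 / 2
  weight_mem _ := by norm_num
  sum_weight _ := by simp

theorem balancedBipartite_hasFreeTransversals (W : Type*) :
    (balancedBipartite W).HasFreeTransversals (oddCycles ⊤) := by
  rintro f F ⟨t, ht, hodd, ⟨e⟩⟩ ⟨c⟩
  -- The chosen labels 2-colour the transversal, hence any cycle in it, but an odd cycle needs three
  -- colours.
  let col : (SimpleGraph.cycleGraph t).Coloring Bool :=
    SimpleGraph.Coloring.mk (fun i => f (c (e.symm i))) fun {i j} h =>
      (c.toHom.map_rel (e.symm.map_rel_iff.2 h)).2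
  have h1 := col.colorable.chromaticNumber_le
  rw [SimpleGraph.chromaticNumber_cycleGraph_of_odd t (by omega) hodd] at h1
  norm_num at h1

theorem balancedBipartite_edgeDensity (W : Type*) {x y : W} (h : x ≠ y) :
    (balancedBipartite W).edgeDensity x y = 1 / 2 := by
  unfold WeightedPartiteGraph.edgeDensity
  change ∑ u : Bool, ∑ v : Bool, _ = _
  simp [balancedBipartite, h]
  norm_num

theorem balancedBipartite_density (W : Type*) [Nontrivial W] :
    (balancedBipartite W).density = 1 / 2 := by
  have : {a : ℝ | ∃ x y : W, (⊤ : SimpleGraph W).Adj x y ∧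
      a = (balancedBipartite W).edgeDensity x y} = {1 / 2} := by
    ext a
    constructor
    · rintro ⟨x, y, h, rfl⟩
      exact balancedBipartite_edgeDensity W h
    · rintro rfl
      obtain ⟨x, y, h⟩ := exists_pair_ne W
      exact ⟨x, y, h, (balancedBipartite_edgeDensity W h).symm⟩
  rw [WeightedPartiteGraph.density, this, csInf_singleton]

theorem proposition1p14 (r : ℕ) (hr : 4 ≤ r) :
    1 / 2 ≤ partiteThreshold (⊤ : SimpleGraph (Fin r)) (oddCycles ⊤) ∧
      (12 ≤ r → partiteThreshold (⊤ : SimpleGraph (Fin r)) (oddCycles ⊤) = 1 / 2) := by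
  have : Nontrivial (Fin r) := Fin.nontrivial_iff_two_le.2 (by omega)
  have hmem : (1 / 2 : ℝ) ∈ {d : ℝ | ∃ G : WeightedPartiteGraph (⊤ : SimpleGraph (Fin r)),
      G.HasFreeTransversals (oddCycles ⊤) ∧ d = G.density} :=
    ⟨_, balancedBipartite_hasFreeTransversals _, (balancedBipartite_density _).symm⟩
  have hlow : 1 / 2 ≤ partiteThreshold (⊤ : SimpleGraph (Fin r)) (oddCycles ⊤) := by
    -- Boundedness matters: the real `sSup` of an unbounded set is 0 by convention.
    refine le_csSup ⟨1, ?_⟩ hmem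
    rintro _ ⟨G, -, rfl⟩
    obtain ⟨x, y, h⟩ := exists_pair_ne (Fin r)
    exact (G.density_le_edgeDensity h).trans (G.edgeDensity_le_one x y)
  refine ⟨hlow, fun hr12 => le_antisymm (csSup_le ⟨_, hmem⟩ ?_) hlow⟩
  rintro _ ⟨G, hG, rfl⟩
  exact G.density_le_half hr12 hG
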